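/- Let $\mathbb K$ be a field and let $E=(E^0,E^1,r,s)$ be a directed graph (of arbitrary cardinality; loops and parallel edges are allowed). A cycle in $E$ is a path $e_1\cdots e_n$ with $n\ge 1$, $r(e_i)=s(e_{i+1})$ for $1\le i<n$, $r(e_n)=s(e_1)$ and $s(e_i)\neq s(e_j)$ for $i\ne j$; cycles that differ only by a cyclic rotation are identified. Suppose that $E$ is row-finite (every vertex emits only finitely many edges) and that $E$ is a comet, that is: $E$ has exactly one cycle $c$; from every vertex of $E$ there is a path (possibly of length $0$) to a vertex of $c$; and every infinite path $f_0f_1f_2\cdots$ of $E$ ends in $c$, i.e. some tail of it is $ccc\cdots$. Let $L_{\mathbb K}(E)$ be the Leavitt path algebra of $E$, i.e. the (not necessarily unital) associative $\mathbb K$-algebra generated by the elements $v\in E^0$ and $e,e^*$ for $e\in E^1$, with the relations $vw=\delta_{v,w}v$ for $v,w\in E^0$; $s(e)e=e\,r(e)=e$ and $r(e)e^*=e^*s(e)=e^*$ for $e\in E^1$; $e^*f=\delta_{e,f}\,r(e)$ for $e,f\in E^1$; and $v=\sum_{s(e)=v}ee^*$ for every vertex $v$ with $s^{-1}(v)$ finite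 and nonempty. For a $\mathbb K$-algebra $A$, the centroid $\mathcal C(A)$ is the $\mathbb K$-algebra, under composition, of all $\mathbb K$-linear maps $\tau:A\to A$ with $\tau(xy)=\tau(x)y=x\tau(y)$ for all $x,y\in A$. Then $\mathcal C(L_{\mathbb K}(E))$ is isomorphic, as a $\mathbb K$-algebra, to the Laurent polynomial algebra $\mathbb K[x,x^{-1}]$. -/

import Mathlib

universe u v w

/-! ### Directed graphs -/

/-- A directed graph with vertex set `V` and edge set `E`. No finiteness is assumed, and loops and
parallel edges are allowed. -/
structure DirectedGraph (V : Type u) (E : Type v) where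
  source : E → V
  range : E → V

namespace DirectedGraph

variable {V : Type u} {E : Type v} (G : DirectedGraph V E)

/-- The edges of the list `p`, in this order, form a path from `a` to `b`. The empty list is the
path of length `0` at a vertex. -/
def IsPath : List E → V → V → Prop
  | [], a, b => a = b
  | e :: p, a, b => G.source e = a ∧ IsPath p (G.range e) b

/-- `G.Reaches a b` is `a ≥ b`, that is, `b` belongs to the tree `T(a)`. -/
def Reaches (a b : V) : Prop :=
  ∃ p : List E, G.IsPath p a b

/-- A cycle `e₁ … eₙ`: a path of positive length with equal source and range, such that
`s(eᵢ) ≠ s(eⱼ)` for `i ≠ j`. -/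
def IsCycle (c : List E) : Prop :=
  c ≠ [] ∧ (∃ a : V, G.IsPath c a a) ∧ (c.map G.source).Nodup

/-- The set `p⁰` of the sources and ranges of the edges of `p`. -/
def pathVertices (p : List E) : Set V :=
  {a | ∃ e ∈ p, G.source e = a ∨ G.range e = a}

/-- An infinite path is a sequence of edges `f₀ f₁ f₂ …` with `r(fᵢ) = s(fᵢ₊₁)`. -/
def IsInfinitePath (f : ℕ → E) : Prop :=
  ∀ i : ℕ, G.range (f i) = G.source (f (i + 1))

/-- The sequence `f` ends in the cycle `p`: from some index on it is `p p p …`. -/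
def EndsIn (f : ℕ → E) (p : List E) : Prop :=
  ∃ n : ℕ, ∀ k : ℕ, p[k % p.length]? = some (f (n + k))

/-- Every vertex emits only finitely many edges. -/
def RowFinite : Prop :=
  ∀ a : V, {e : E | G.source e = a}.Finite

/-- A comet: there is exactly one cycle `c` (cycles that differ only by the choice of the base
vertex, i.e. by a rotation of the list of edges, are the same cycle), every vertex connects to
`c`, and every infinite path ends in `c`. -/
def IsComet : Prop :=
  ∃ c : List E, G.IsCycle c ∧ (∀ d : List E, G.IsCycle d → d ~r c) ∧
    (∀ a : V, ∃ b ∈ G.pathVertices c, G.Reaches a b) ∧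
    (∀ f : ℕ → E, G.IsInfinitePath f → EndsIn f c)

end DirectedGraph

/-! ### Leavitt path algebras -/

/-- The generators of a Leavitt path algebra: vertices `v`, (real) edges `e`, ghost edges `e*`. -/
inductive LeavittGen (V : Type u) (E : Type v) : Type (max u v)
  | vertex (a : V)
  | edge (e : E)
  | ghost (e : E)

/-- The free associative (non-unital) `R`-algebra on the generators. -/
abbrev FreeLeavitt (R : Type w) [CommRing R] (V : Type u) (E : Type v) : Type (max u v w) :=
  MonoidAlgebra R (FreeSemigroup (LeavittGen V E))

namespace FreeLeavitt

noncomputable section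

variable (R : Type w) [CommRing R] {V : Type u} {E : Type v}

/-- A vertex as an element of the free algebra. -/
def vertex (a : V) : FreeLeavitt R V E :=
  MonoidAlgebra.single (FreeSemigroup.of (LeavittGen.vertex a)) 1

/-- A real edge as an element of the free algebra. -/
def edge (e : E) : FreeLeavitt R V E :=
  MonoidAlgebra.single (FreeSemigroup.of (LeavittGen.edge e)) 1

/-- A ghost edge as an element of the free algebra. -/
def ghost (e : E) : FreeLeavitt R V E :=
  MonoidAlgebra.single (FreeSemigroup.of (LeavittGen.ghost e)) 1

end

end FreeLeavitt

namespace DirectedGraph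

noncomputable section

variable {V : Type u} {E : Type v} (G : DirectedGraph V E)

open FreeLeavitt in
/-- The defining relations (V), (E1), (E2), (CK1), (CK2). In (CK2), the set `s⁻¹(a)` is finite and
nonempty, i.e. `a` is a regular vertex. -/
inductive LeavittRel (R : Type w) [CommRing R] : FreeLeavitt R V E → FreeLeavitt R V E → Prop
  | vertex_mul_self (a : V) : LeavittRel R (vertex R a * vertex R a) (vertex R a)
  | vertex_mul_of_ne (a b : V) (h : a ≠ b) : LeavittRel R (vertex R a * vertex R b) 0
  | source_mul_edge (e : E) : LeavittRel R (vertex R (G.source e) * edge R e) (edge R e)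
  | edge_mul_range (e : E) : LeavittRel R (edge R e * vertex R (G.range e)) (edge R e)
  | range_mul_ghost (e : E) : LeavittRel R (vertex R (G.range e) * ghost R e) (ghost R e)
  | ghost_mul_source (e : E) : LeavittRel R (ghost R e * vertex R (G.source e)) (ghost R e)
  | ghost_mul_edge_self (e : E) : LeavittRel R (ghost R e * edge R e) (vertex R (G.range e))
  | ghost_mul_edge_of_ne (e f : E) (h : e ≠ f) : LeavittRel R (ghost R e * edge R f) 0
  | ck2 (a : V) (S : Finset E) (hS : ∀ e : E, e ∈ S ↔ G.source e = a) (hne : S.Nonempty) :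
      LeavittRel R (vertex R a) (∑ e ∈ S, edge R e * ghost R e)

/-- The two-sided (algebra) ideal generated by the defining relations: the smallest submodule
that contains them and is stable under multiplication from both sides. -/
def leavittIdeal (R : Type w) [CommRing R] : Submodule R (FreeLeavitt R V E) :=
  sInf {I | (∀ x y, G.LeavittRel R x y → x - y ∈ I) ∧
    ∀ a, ∀ x ∈ I, a * x ∈ I ∧ x * a ∈ I}

variable {G} in
theorem mul_mem_leavittIdeal {R : Type w} [CommRing R] (a : FreeLeavitt R V E)
    {x : FreeLeavitt R V E} (hx : x ∈ G.leavittIdeal R) :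
    a * x ∈ G.leavittIdeal R ∧ x * a ∈ G.leavittIdeal R := by
  simp only [leavittIdeal, Submodule.mem_sInf] at hx ⊢
  exact ⟨fun I hI => (hI.2 a x (hx I hI)).1, fun I hI => (hI.2 a x (hx I hI)).2⟩

/-- The Leavitt path algebra `L_R(E)` of a graph, an associative, in general non-unital,
`R`-algebra. -/
def LeavittPathAlgebra (R : Type w) [CommRing R] : Type (max u v w) :=
  FreeLeavitt R V E ⧸ G.leavittIdeal R

namespace LeavittPathAlgebra

variable (R : Type w) [CommRing R]

instance instAddCommGroup : AddCommGroup (G.LeavittPathAlgebra R) :=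
  inferInstanceAs (AddCommGroup (FreeLeavitt R V E ⧸ G.leavittIdeal R))

instance instModule : Module R (G.LeavittPathAlgebra R) :=
  inferInstanceAs (Module R (FreeLeavitt R V E ⧸ G.leavittIdeal R))

/-- The quotient map from the free algebra. -/
def mk : FreeLeavitt R V E →ₗ[R] G.LeavittPathAlgebra R :=
  (G.leavittIdeal R).mkQ

theorem mk_surjective : Function.Surjective (mk G R) :=
  (G.leavittIdeal R).mkQ_surjective

/-- The multiplication induced by that of the free algebra. -/
instance instMul : Mul (G.LeavittPathAlgebra R) where
  mul := Quotient.map₂ (· * ·) (by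
    intro a a' ha b b' hb
    have ha' := (Submodule.quotientRel_def _).1 ha
    have hb' := (Submodule.quotientRel_def _).1 hb
    refine (Submodule.quotientRel_def _).2 ?_
    have h := (G.leavittIdeal R).add_mem (mul_mem_leavittIdeal b ha').2
      (mul_mem_leavittIdeal a' hb').1
    have e : (a - a') * b + a' * (b - b') = a * b - a' * b' := by
      rw [sub_mul, mul_sub]; abel
    rwa [e] at h)

theorem mk_mul (x y : FreeLeavitt R V E) : mk G R (x * y) = mk G R x * mk G R y := rfl

instance instNonUnitalRing : NonUnitalRing (G.LeavittPathAlgebra R) where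
  __ := instAddCommGroup G R
  __ := instMul G R
  left_distrib a b c := by
    obtain ⟨a, rfl⟩ := mk_surjective G R a
    obtain ⟨b, rfl⟩ := mk_surjective G R b
    obtain ⟨c, rfl⟩ := mk_surjective G R c
    rw [← map_add, ← mk_mul, ← mk_mul, ← mk_mul, ← map_add, mul_add]
  right_distrib a b c := by
    obtain ⟨a, rfl⟩ := mk_surjective G R a
    obtain ⟨b, rfl⟩ := mk_surjective G R b
    obtain ⟨c, rfl⟩ := mk_surjective G R c
    rw [← map_add, ← mk_mul, ← mk_mul, ← mk_mul, ← map_add, add_mul]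
  zero_mul a := by
    obtain ⟨a, rfl⟩ := mk_surjective G R a
    rw [← map_zero (mk G R), ← mk_mul, zero_mul]
  mul_zero a := by
    obtain ⟨a, rfl⟩ := mk_surjective G R a
    rw [← map_zero (mk G R), ← mk_mul, mul_zero]
  mul_assoc a b c := by
    obtain ⟨a, rfl⟩ := mk_surjective G R a
    obtain ⟨b, rfl⟩ := mk_surjective G R b
    obtain ⟨c, rfl⟩ := mk_surjective G R c
    rw [← mk_mul, ← mk_mul, ← mk_mul, ← mk_mul, mul_assoc]

instance instIsScalarTower : IsScalarTower R (G.LeavittPathAlgebra R) (G.LeavittPathAlgebra R) where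
  smul_assoc r a b := by
    obtain ⟨a, rfl⟩ := mk_surjective G R a
    obtain ⟨b, rfl⟩ := mk_surjective G R b
    rw [smul_eq_mul, smul_eq_mul, ← map_smul, ← mk_mul, ← mk_mul, ← map_smul, smul_mul_assoc]

instance instSMulCommClass : SMulCommClass R (G.LeavittPathAlgebra R) (G.LeavittPathAlgebra R) where
  smul_comm r a b := by
    obtain ⟨a, rfl⟩ := mk_surjective G R a
    obtain ⟨b, rfl⟩ := mk_surjective G R b
    rw [smul_eq_mul, smul_eq_mul, ← map_smul, ← mk_mul, ← mk_mul, ← map_smul, mul_smul_comm]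

end LeavittPathAlgebra

end

end DirectedGraph

/-! ### The centroid -/

/-- The centroid of a (not necessarily unital) associative `R`-algebra `A`: the algebra, under
composition, of the `R`-linear maps `t : A → A` such that `t (x * y) = t x * y = x * t y`. -/
def centroidAlgebra (R : Type u) (A : Type v) [CommRing R] [NonUnitalRing A] [Module R A]
    [IsScalarTower R A A] [SMulCommClass R A A] : Subalgebra R (Module.End R A) where
  carrier := {t | ∀ x y : A, t (x * y) = t x * y ∧ t (x * y) = x * t y}
  mul_mem' := by
    intro s t hs ht x y
    constructor
    · rw [Module.End.mul_apply, Module.End.mul_apply, (ht x y).1, (hs _ _).1]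
    · rw [Module.End.mul_apply, Module.End.mul_apply, (ht x y).2, (hs _ _).2]
  add_mem' := by
    intro s t hs ht x y
    constructor
    · rw [LinearMap.add_apply, LinearMap.add_apply, (hs x y).1, (ht x y).1, add_mul]
    · rw [LinearMap.add_apply, LinearMap.add_apply, (hs x y).2, (ht x y).2, mul_add]
  algebraMap_mem' := by
    intro r x y
    simp only [Module.algebraMap_end_apply]
    exact ⟨(smul_mul_assoc r x y).symm, (mul_smul_comm r x y).symm⟩

/-! Fix a vertex `a` on the cycle `c`. Every closed path runs along `c`, because its infinite
repetition must end in `c`; hence `c` has no exits and the closed paths at `a` are exactly the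
powers of `c`. In the Leavitt path algebra `L` this makes `c` a unit of the corner `a L a` with
inverse `c*`, and the corner is spanned by the integer powers of `c` (`corner_mem_range`). These are
linearly independent, as seen in a representation on functions on the infinite paths in which edges
also multiply by a variable (`laurentHom_injective`). So `a L a` is the Laurent polynomial algebra.

The idempotent `a` is full (`span_eq_top`): by (CK2), a vertex outside the ideal generated by `a`
would start an infinite path avoiding `a`. Together with local units this gives nondegeneracy
(`eq_zero_of_corner_eq_zero`).

Finally, a centroid element `t` is determined by `t e`, where `e` is a full idempotent with
commutative corner, and `t e` lies in that corner. Conversely, each `b` in the corner yields `∑ x e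
y ↦ ∑ x b y`; commutativity of the corner and nondegeneracy make this well defined
(`nonempty_centroidAlgebra_equiv_of_full_corner`). -/

/-! ### Centroids of algebras with a full commutative corner -/

/-- If `ψ` identifies a commutative algebra `B` with the corner `e A e` of a full idempotent
`e = ψ 1` of a nondegenerate algebra `A`, then `B` is the centroid of `A`. -/
theorem nonempty_centroidAlgebra_equiv_of_full_corner {K : Type w} [Field K] {A : Type u}
    [NonUnitalRing A] [Module K A] [IsScalarTower K A A] [SMulCommClass K A A] {B : Type v}
    [CommRing B] [Algebra K B] (ψ : B →ₙₐ[K] A) (hinj : Function.Injective ψ)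
    (hcorner : ∀ x : A, ψ 1 * x * ψ 1 ∈ Set.range ψ)
    (hfull : Submodule.span K {z : A | ∃ x y, z = x * ψ 1 * y} = ⊤)
    (hnd : ∀ w : A, (∀ x y, ψ 1 * x * w * y * ψ 1 = 0) → w = 0) :
    Nonempty (centroidAlgebra K A ≃ₐ[K] B) := by
  have h1 : ∀ b, ψ 1 * ψ b = ψ b := fun b => by rw [← map_mul, one_mul]
  have h2 : ∀ b, ψ b * ψ 1 = ψ b := fun b => by rw [← map_mul, mul_one]
  -- Both `ψ b` and `ψ 1 * x * ψ 1` lie in the commutative image of `ψ`, so they commute.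
  have hcomm : ∀ b x, ψ 1 * x * ψ b = ψ b * x * ψ 1 := fun b x => by
    obtain ⟨d, hd⟩ := hcorner x
    calc ψ 1 * x * ψ b = ψ 1 * x * ψ 1 * ψ b := by rw [mul_assoc _ (ψ 1), h1]
      _ = ψ b * (ψ 1 * x * ψ 1) := by rw [← hd, ← map_mul, mul_comm, map_mul]
      _ = ψ b * x * ψ 1 := by rw [← mul_assoc, ← mul_assoc, h2]
  have hC1 : ∀ (t : centroidAlgebra K A) (x y : A), t.1 (x * y) = t.1 x * y :=
    fun t x y => (t.2 x y).1
  have hC2 : ∀ (t : centroidAlgebra K A) (x y : A), t.1 (x * y) = x * t.1 y :=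
    fun t x y => (t.2 x y).2
  let ev : centroidAlgebra K A →ₗ[K] A :=
    { toFun := fun t => t.1 (ψ 1)
      map_add' := fun _ _ => rfl
      map_smul' := fun _ _ => rfl }
  have hev : ∀ t, ev t = t.1 (ψ 1) := fun _ => rfl
  have evinj : Function.Injective ev := by
    rw [← LinearMap.ker_eq_bot, LinearMap.ker_eq_bot']
    intro t ht
    apply Subtype.ext
    apply LinearMap.ext
    intro z
    have hz : z ∈ Submodule.span K {z : A | ∃ x y, z = x * ψ 1 * y} := by
      rw [hfull]; trivial
    induction hz using Submodule.span_induction with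
    | mem z hz =>
      obtain ⟨x, y, rfl⟩ := hz
      rw [hC1, hC2, ← hev, ht, mul_zero, zero_mul]
      rfl
    | zero => simp
    | add x y _ _ hx hy => rw [map_add, hx, hy, map_add]
    | smul a x _ hx => rw [map_smul, hx, map_smul]
  have evmem : ∀ t, ∃ b, ψ b = ev t := fun t => by
    obtain ⟨b, hb⟩ := hcorner (t.1 (ψ 1))
    refine ⟨b, hb.trans ?_⟩
    rw [← hC2, ← hC1, h1, h1, hev]
  -- The prospective centroid map on formal sums of pairs `(x, y)`, before passing to the elements
  -- `∑ x e y` that they represent.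
  let F : B → (A × A →₀ K) →ₗ[K] A := fun b =>
    Finsupp.linearCombination K (fun p : A × A => p.1 * ψ b * p.2)
  have F1 : LinearMap.range (F 1) = ⊤ := by
    rw [Finsupp.range_linearCombination, ← hfull]
    congr 1
    ext z
    simp [eq_comm]
  have key : ∀ b s x y, ψ 1 * x * F b s * y * ψ 1 = ψ b * x * F 1 s * y * ψ 1 := by
    intro b s x y
    induction s using Finsupp.induction_linear with
    | zero => simp
    | add s t hs ht => simp only [map_add, mul_add, add_mul, hs, ht]
    | single p a =>
      simp only [F, Finsupp.linearCombination_single, mul_smul_comm, smul_mul_assoc]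
      congr 1
      have := hcomm b (x * p.1)
      simp only [← mul_assoc] at this ⊢
      rw [this]
  -- Well-definedness: if `∑ x e y = 0`, then by `key` the element `∑ x b y` is killed by all the
  -- products in `hnd`.
  have hker : ∀ b, LinearMap.ker (F 1) ≤ LinearMap.ker (F b) := by
    intro b s hs
    rw [LinearMap.mem_ker] at hs ⊢
    refine hnd _ fun x y => ?_
    rw [key, hs]
    simp
  have evsurj : ∀ b, ∃ t, ev t = ψ b := by
    intro b
    let e₁ := (F 1).quotKerEquivOfSurjective (LinearMap.range_eq_top.1 F1)
    let t : A →ₗ[K] A := (Submodule.liftQ _ (F b) (hker b)).comp e₁.symm.toLinearMap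
    have ht : ∀ s, t (F 1 s) = F b s := by
      intro s
      have : e₁.symm (F 1 s) = Submodule.Quotient.mk s := by
        rw [LinearEquiv.symm_apply_eq]; rfl
      simp only [t, LinearMap.comp_apply, LinearEquiv.coe_coe, this]
      rfl
    have ht' : ∀ x y, t (x * ψ 1 * y) = x * ψ b * y := by
      intro x y
      have := ht (Finsupp.single (x, y) 1)
      simpa [F] using this
    have hsurj : ∀ x, ∃ s, F 1 s = x := LinearMap.range_eq_top.1 F1
    have htC : t ∈ centroidAlgebra K A := by
      intro x y
      constructor
      · obtain ⟨s, rfl⟩ := hsurj x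
        induction s using Finsupp.induction_linear with
        | zero => simp
        | add s s' hs hs' => simp only [map_add, add_mul, hs, hs']
        | single p a =>
          simp only [F, Finsupp.linearCombination_single, smul_mul_assoc, map_smul, ht']
          rw [mul_assoc (p.1 * ψ 1), ht', mul_assoc (p.1 * ψ b)]
      · obtain ⟨s, rfl⟩ := hsurj y
        induction s using Finsupp.induction_linear with
        | zero => simp
        | add s s' hs hs' => simp only [map_add, mul_add, hs, hs']
        | single p a =>
          simp only [F, Finsupp.linearCombination_single, mul_smul_comm, map_smul, ht']
          rw [← mul_assoc, ← mul_assoc, ht', ← mul_assoc, ← mul_assoc]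
    refine ⟨⟨t, htC⟩, ?_⟩
    have := ht' (ψ 1) (ψ 1)
    rwa [h1, h1, h1, h2] at this
  let e₁ : centroidAlgebra K A ≃ₗ[K] LinearMap.range ev := LinearEquiv.ofInjective ev evinj
  let e₂ : B ≃ₗ[K] LinearMap.range (ψ : B →ₗ[K] A) := LinearEquiv.ofInjective _ hinj
  have hr : LinearMap.range ev = LinearMap.range (ψ : B →ₗ[K] A) := by
    ext z
    constructor
    · rintro ⟨t, rfl⟩; exact evmem t
    · rintro ⟨b, rfl⟩; exact evsurj b
  let e₃ : centroidAlgebra K A ≃ₗ[K] B := (e₁.trans (LinearEquiv.ofEq _ _ hr)).trans e₂.symm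
  have he₃ : ∀ t, ψ (e₃ t) = ev t := by
    intro t
    have : e₂ (e₃ t) = LinearEquiv.ofEq _ _ hr (e₁ t) := e₂.apply_symm_apply _
    exact congrArg Subtype.val this
  refine ⟨AlgEquiv.ofLinearEquiv e₃ (hinj ?_) fun s t => hinj ?_⟩
  · rw [he₃]; rfl
  · rw [map_mul ψ, he₃, he₃, he₃]
    calc ev (s * t) = s.1 (ev t) := rfl
      _ = s.1 (ψ 1 * ev t) := by rw [hev, ← hC2, h1]
      _ = ev s * ev t := by rw [hC1]; rfl

/-! ### Paths and closed paths in a comet -/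

namespace DirectedGraph

variable {V : Type u} {E : Type v} {G : DirectedGraph V E}

theorem isPath_append {p q : List E} {a d : V} :
    G.IsPath (p ++ q) a d ↔ ∃ b, G.IsPath p a b ∧ G.IsPath q b d := by
  induction p generalizing a with
  | nil => simp [IsPath]
  | cons e p ih => simp [IsPath, ih, and_assoc]

theorem IsPath.range_unique {p : List E} {a b d : V} (hb : G.IsPath p a b)
    (hd : G.IsPath p a d) : b = d := by
  induction p generalizing a with
  | nil => exact hb.symm.trans hd
  | cons e p ih => exact ih hb.2 hd.2

theorem Reaches.trans {a b d : V} (h : G.Reaches a b) (h' : G.Reaches b d) : G.Reaches a d := by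
  obtain ⟨p, hp⟩ := h
  obtain ⟨q, hq⟩ := h'
  exact ⟨p ++ q, isPath_append.2 ⟨b, hp, hq⟩⟩

theorem reaches_range (e : E) : G.Reaches (G.source e) (G.range e) := ⟨[e], rfl, rfl⟩

theorem IsPath.reaches_source_of_mem {p : List E} {a b : V} (hp : G.IsPath p a b) {e : E}
    (he : e ∈ p) : G.Reaches a (G.source e) ∧ G.Reaches (G.range e) b := by
  obtain ⟨l, m, rfl⟩ := List.append_of_mem he
  obtain ⟨x, hl, rfl, hm⟩ := isPath_append.1 hp
  exact ⟨⟨l, hl⟩, ⟨m, hm⟩⟩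

theorem IsPath.range_getElem {p : List E} {a b : V} (hp : G.IsPath p a b) {i : ℕ}
    (hi : i < p.length) :
    (∀ hi' : i + 1 < p.length, G.range p[i] = G.source p[i + 1]) ∧
      (i + 1 = p.length → G.range p[i] = b) := by
  induction p generalizing a i with
  | nil => simp at hi
  | cons e p ih =>
    obtain ⟨rfl, hp⟩ := hp
    cases i with
    | zero =>
      cases p with
      | nil => exact ⟨by simp, fun _ => hp⟩
      | cons f p => exact ⟨fun _ => hp.1.symm, by simp⟩
    | succ i =>
      have := ih hp (i := i) (by simpa using hi)
      simpa using this

/-- The infinite repetition `p p p …` of a nonempty list. -/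
def cycleForever (p : List E) (hp : p ≠ []) (k : ℕ) : E :=
  p[k % p.length]'(Nat.mod_lt _ (List.length_pos_of_ne_nil hp))

theorem IsPath.isInfinitePath_cycleForever {p : List E} {a : V} (h : G.IsPath p a a)
    (hp : p ≠ []) : G.IsInfinitePath (cycleForever p hp) := by
  have hpos := List.length_pos_of_ne_nil hp
  intro i
  have hlt := Nat.mod_lt i hpos
  have hs : G.source p[0] = a := by
    cases p with
    | nil => exact absurd rfl hp
    | cons e p => exact h.1
  have hr := h.range_getElem hlt
  unfold cycleForever
  rcases Nat.lt_or_ge (i % p.length + 1) p.length with h1 | h1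
  · rw [hr.1 h1]
    have : (i + 1) % p.length = i % p.length + 1 := by
      rw [← Nat.mod_add_mod, Nat.mod_eq_of_lt h1]
    simp only [this]
  · have h1 : i % p.length + 1 = p.length := le_antisymm hlt h1
    rw [hr.2 h1]
    have : (i + 1) % p.length = 0 := by
      rw [← Nat.mod_add_mod, h1, Nat.mod_self]
    simp only [this, hs]

theorem EndsIn.exists_eq {f : ℕ → E} {c : List E} (h : EndsIn f c) {e : E}
    (he : e ∈ c) : ∃ k, f k = e := by
  obtain ⟨n, hn⟩ := h
  obtain ⟨i, hi, rfl⟩ := List.getElem_of_mem he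
  refine ⟨n + i, ?_⟩
  have := hn i
  rw [Nat.mod_eq_of_lt hi, List.getElem?_eq_getElem hi] at this
  exact (Option.some.inj this).symm

theorem EndsIn.eventually_mem {f : ℕ → E} {c : List E} (h : EndsIn f c) :
    ∃ n, ∀ k, f (n + k) ∈ c := by
  obtain ⟨n, hn⟩ := h
  exact ⟨n, fun k => List.mem_of_getElem? (hn k)⟩

/-- In a graph all of whose infinite paths end in `c`, every edge of a closed path lies on `c`. -/
theorem IsPath.mem_of_mem_of_endsIn {c : List E} (hinf : ∀ f, G.IsInfinitePath f → EndsIn f c)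
    {p : List E} {a : V} (h : G.IsPath p a a) {e : E} (he : e ∈ p) : e ∈ c := by
  have hp := List.ne_nil_of_mem he
  obtain ⟨n, hn⟩ := (hinf _ (h.isInfinitePath_cycleForever hp)).eventually_mem
  obtain ⟨i, hi, rfl⟩ := List.getElem_of_mem he
  have hpos := List.length_pos_of_ne_nil hp
  have hle : n ≤ p.length * n := Nat.le_mul_of_pos_left n hpos
  -- The copy of the edge at index `i + p.length * n` lies past `n`; `hle` makes the truncated
  -- subtraction exact.
  have := hn (p.length * n - n + i)
  rw [show n + (p.length * n - n + i) = i + p.length * n by omega] at this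
  simpa [cycleForever, Nat.mod_eq_of_lt hi] using this

/-- The data of a comet, with a base vertex `a` on its cycle `c`: every vertex reaches `a`, distinct
edges reachable from `a` have distinct sources, and every infinite path passes through `a`. -/
structure IsBasedComet (G : DirectedGraph V E) (c : List E) (a : V) : Prop where
  ne_nil : c ≠ []
  isPath : G.IsPath c a a
  nodup : (c.map G.source).Nodup
  reaches : ∀ b, G.Reaches b a
  eq_of_source_eq : ∀ e f, G.Reaches a (G.source e) → G.source e = G.source f → e = f
  exists_source_eq : ∀ f, G.IsInfinitePath f → ∃ k, G.source (f k) = a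

/-- An edge starting at a vertex reachable from `a` can be completed to a closed path at `a`, since
every vertex reaches `a`. It therefore lies on `c`, where sources are distinct: `c` has no exits. -/
theorem IsComet.exists_isBasedComet (h : G.IsComet) : ∃ c a, G.IsBasedComet c a := by
  obtain ⟨c, ⟨hc, ⟨a, ha⟩, hnd⟩, -, hreach, hinf⟩ := h
  have hback : ∀ b, G.Reaches b a := by
    intro b
    obtain ⟨x, ⟨e, he, hx⟩, hb⟩ := hreach b
    refine hb.trans ?_
    have := (ha.reaches_source_of_mem he).2
    rcases hx with rfl | rfl
    · exact (reaches_range e).trans this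
    · exact this
  have hmem : ∀ e, G.Reaches a (G.source e) → e ∈ c := by
    intro e he
    obtain ⟨p, hp⟩ := he
    obtain ⟨q, hq⟩ := hback (G.range e)
    exact IsPath.mem_of_mem_of_endsIn hinf
      (isPath_append.2 ⟨_, hp, rfl, hq⟩ : G.IsPath (p ++ e :: q) a a) (by simp)
  refine ⟨c, a, hc, ha, hnd, hback, fun e f he hef => ?_, fun f hf => ?_⟩
  · exact List.inj_on_of_nodup_map hnd (hmem e he) (hmem f (hef ▸ he)) hef
  · cases c with
    | nil => exact absurd rfl hc
    | cons e c =>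
      obtain ⟨k, hk⟩ := (hinf f hf).exists_eq (List.mem_cons_self)
      exact ⟨k, hk ▸ ha.1⟩

namespace IsBasedComet

variable {c : List E} {a : V}

/-- Beyond `a` there is never a choice of the next edge, so two paths with the same start agree
until the shorter one stops. -/
theorem prefix_or_prefix (h : G.IsBasedComet c a) {p q : List E} {x b d : V}
    (hx : G.Reaches a x) (hp : G.IsPath p x b) (hq : G.IsPath q x d) : p <+: q ∨ q <+: p := by
  induction p generalizing q x with
  | nil => simp
  | cons e p ih =>
    cases q with
    | nil => simp
    | cons f q =>
      obtain ⟨rfl, hp⟩ := hp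
      obtain ⟨hf, hq⟩ := hq
      obtain rfl := h.eq_of_source_eq e f hx hf.symm
      simpa using ih (hx.trans (reaches_range e)) hp hq

/-- Splits off one turn of `c`. A nonempty closed path at `a` cannot be a proper prefix of `c`,
because the next edge of `c` would again have source `a`, against `nodup`. -/
theorem exists_eq_append (h : G.IsBasedComet c a) {p : List E} (hp : G.IsPath p a a)
    (hne : p ≠ []) :
    ∃ q, p = c ++ q ∧ G.IsPath q a a := by
  have key : ∀ q, p = c ++ q → ∃ q, p = c ++ q ∧ G.IsPath q a a := by
    rintro q rfl
    refine ⟨q, rfl, ?_⟩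
    obtain ⟨b, hb, hq⟩ := isPath_append.1 hp
    rwa [hb.range_unique h.isPath] at hq
  rcases h.prefix_or_prefix ⟨[], rfl⟩ hp h.isPath with ⟨r, hr⟩ | ⟨r, hr⟩
  · cases r with
    | nil => exact key [] (by simpa using hr)
    | cons f r =>
      exfalso
      have hc := h.isPath
      have hnd := h.nodup
      rw [← hr] at hc hnd
      cases p with
      | nil => exact hne rfl
      | cons e p =>
        obtain ⟨b, hb, hf, -⟩ := isPath_append.1 hc
        have hba := hb.range_unique hp
        simp only [List.cons_append, List.map_cons, List.map_append, List.nodup_cons] at hnd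
        apply hnd.1
        rw [hp.1, ← hba, ← hf]
        simp
  · exact key r hr.symm

end IsBasedComet

end DirectedGraph

/-! ### Generators, local units and paths in the Leavitt path algebra -/

namespace DirectedGraph

noncomputable section

variable {V : Type u} {E : Type v} (G : DirectedGraph V E) (R : Type w) [CommRing R]

namespace LeavittPathAlgebra

/-- A vertex as an element of the Leavitt path algebra. -/
def vertex (a : V) : G.LeavittPathAlgebra R := mk G R (FreeLeavitt.vertex R a)

/-- A real edge as an element of the Leavitt path algebra. -/
def edge (e : E) : G.LeavittPathAlgebra R := mk G R (FreeLeavitt.edge R e)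

/-- A ghost edge as an element of the Leavitt path algebra. -/
def ghost (e : E) : G.LeavittPathAlgebra R := mk G R (FreeLeavitt.ghost R e)

variable {G R}

theorem mk_eq_of_leavittRel {x y : FreeLeavitt R V E} (h : G.LeavittRel R x y) :
    mk G R x = mk G R y := by
  refine (Submodule.Quotient.eq _).2 ?_
  rw [leavittIdeal, Submodule.mem_sInf]
  exact fun I hI => hI.1 x y h

theorem vertex_mul_self (a : V) : vertex G R a * vertex G R a = vertex G R a :=
  mk_eq_of_leavittRel (.vertex_mul_self a)

theorem vertex_mul_of_ne {a b : V} (h : a ≠ b) : vertex G R a * vertex G R b = 0 :=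
  (mk_eq_of_leavittRel (.vertex_mul_of_ne a b h)).trans (map_zero _)

theorem source_mul_edge (e : E) : vertex G R (G.source e) * edge G R e = edge G R e :=
  mk_eq_of_leavittRel (.source_mul_edge e)

theorem edge_mul_range (e : E) : edge G R e * vertex G R (G.range e) = edge G R e :=
  mk_eq_of_leavittRel (.edge_mul_range e)

theorem range_mul_ghost (e : E) : vertex G R (G.range e) * ghost G R e = ghost G R e :=
  mk_eq_of_leavittRel (.range_mul_ghost e)

theorem ghost_mul_source (e : E) : ghost G R e * vertex G R (G.source e) = ghost G R e :=
  mk_eq_of_leavittRel (.ghost_mul_source e)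

theorem ghost_mul_edge_self (e : E) : ghost G R e * edge G R e = vertex G R (G.range e) :=
  mk_eq_of_leavittRel (.ghost_mul_edge_self e)

theorem ghost_mul_edge_of_ne {e f : E} (h : e ≠ f) : ghost G R e * edge G R f = 0 :=
  (mk_eq_of_leavittRel (.ghost_mul_edge_of_ne e f h)).trans (map_zero _)

theorem vertex_eq_sum {a : V} {S : Finset E} (hS : ∀ e, e ∈ S ↔ G.source e = a)
    (hne : S.Nonempty) : vertex G R a = ∑ e ∈ S, edge G R e * ghost G R e :=
  (mk_eq_of_leavittRel (.ck2 a S hS hne)).trans (map_sum _ _ _)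

/-- A set of elements that contains the generators and is closed under linear combinations and
under multiplication by generators from the left is everything. -/
theorem mem_of_generators (N : Submodule R (G.LeavittPathAlgebra R))
    (hv : ∀ a, vertex G R a ∈ N) (he : ∀ e, edge G R e ∈ N) (hg : ∀ e, ghost G R e ∈ N)
    (mv : ∀ a, ∀ x ∈ N, vertex G R a * x ∈ N) (me : ∀ e, ∀ x ∈ N, edge G R e * x ∈ N)
    (mg : ∀ e, ∀ x ∈ N, ghost G R e * x ∈ N) (x : G.LeavittPathAlgebra R) : x ∈ N := by
  obtain ⟨x, rfl⟩ := mk_surjective G R x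
  induction x using MonoidAlgebra.induction_linear with
  | zero => simp
  | add x y hx hy => rw [map_add]; exact N.add_mem hx hy
  | single m r =>
    have hr : (MonoidAlgebra.single m r : FreeLeavitt R V E) = r • MonoidAlgebra.single m 1 := by
      simp
    rw [hr, map_smul]
    refine N.smul_mem r ?_
    have hof : ∀ g, mk G R (MonoidAlgebra.single (FreeSemigroup.of g) 1) ∈ N := by
      rintro (a | e | e)
      exacts [hv a, he e, hg e]
    induction m using FreeSemigroup.recOnMul with
    | ih1 g => exact hof g
    | ih2 g m _ hm =>
      have : (MonoidAlgebra.single (FreeSemigroup.of g * m) 1 : FreeLeavitt R V E) =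
          MonoidAlgebra.single (FreeSemigroup.of g) 1 * MonoidAlgebra.single m 1 := by
        rw [MonoidAlgebra.single_mul_single, one_mul]
      rw [this, mk_mul]
      rcases g with a | e | e
      exacts [mv a _ (hm (by simp)), me e _ (hm (by simp)), mg e _ (hm (by simp))]

variable (G R) in
/-- The sum of the vertices in a finite set. -/
def vertexSum (S : Finset V) : G.LeavittPathAlgebra R := ∑ a ∈ S, vertex G R a

theorem vertexSum_mul_of_mem {S : Finset V} {a : V} (ha : a ∈ S) {x : G.LeavittPathAlgebra R}
    (hx : vertex G R a * x = x) : vertexSum G R S * x = x := by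
  classical
  rw [vertexSum, Finset.sum_mul, Finset.sum_eq_single a, hx]
  · intro b _ hb
    rw [← hx, ← mul_assoc, vertex_mul_of_ne hb, zero_mul]
  · exact fun h => absurd ha h

theorem mul_vertexSum_of_mem {S : Finset V} {a : V} (ha : a ∈ S) {x : G.LeavittPathAlgebra R}
    (hx : x * vertex G R a = x) : x * vertexSum G R S = x := by
  classical
  rw [vertexSum, Finset.mul_sum, Finset.sum_eq_single a, hx]
  · intro b _ hb
    rw [← hx, mul_assoc, vertex_mul_of_ne hb.symm, mul_zero]
  · exact fun h => absurd ha h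

/-- Leavitt path algebras have local units: left units. -/
theorem exists_vertexSum_mul (x : G.LeavittPathAlgebra R) :
    ∃ S : Finset V, ∀ S', S ⊆ S' → vertexSum G R S' * x = x := by
  classical
  let N : Submodule R (G.LeavittPathAlgebra R) :=
    { carrier := {x | ∃ S : Finset V, ∀ S', S ⊆ S' → vertexSum G R S' * x = x}
      zero_mem' := ⟨∅, fun _ _ => mul_zero _⟩
      add_mem' := by
        rintro x y ⟨S, hS⟩ ⟨T, hT⟩
        refine ⟨S ∪ T, fun S' h => ?_⟩
        rw [mul_add, hS _ (Finset.union_subset_left h), hT _ (Finset.union_subset_right h)]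
      smul_mem' := by
        rintro r x ⟨S, hS⟩
        exact ⟨S, fun S' h => by rw [mul_smul_comm, hS _ h]⟩ }
  have key : ∀ a x, vertex G R a * x = x → x ∈ N := fun a x hx =>
    ⟨{a}, fun S' h => vertexSum_mul_of_mem (h (Finset.mem_singleton_self a)) hx⟩
  -- A product beginning with a generator is fixed by the vertex on the left of that generator,
  -- whatever the other factor is.
  refine mem_of_generators N (fun a => key a _ (vertex_mul_self a))
    (fun e => key _ _ (source_mul_edge e)) (fun e => key _ _ (range_mul_ghost e))
    (fun a x _ => key a _ ?_) (fun e x _ => key (G.source e) _ ?_)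
    (fun e x _ => key (G.range e) _ ?_) x
  · rw [← mul_assoc, vertex_mul_self]
  · rw [← mul_assoc, source_mul_edge]
  · rw [← mul_assoc, range_mul_ghost]

/-- Leavitt path algebras have local units: right units. -/
theorem exists_mul_vertexSum (x : G.LeavittPathAlgebra R) :
    ∃ S : Finset V, ∀ S', S ⊆ S' → x * vertexSum G R S' = x := by
  classical
  let N : Submodule R (G.LeavittPathAlgebra R) :=
    { carrier := {x | ∃ S : Finset V, ∀ S', S ⊆ S' → x * vertexSum G R S' = x}
      zero_mem' := ⟨∅, fun _ _ => zero_mul _⟩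
      add_mem' := by
        rintro x y ⟨S, hS⟩ ⟨T, hT⟩
        refine ⟨S ∪ T, fun S' h => ?_⟩
        rw [add_mul, hS _ (Finset.union_subset_left h), hT _ (Finset.union_subset_right h)]
      smul_mem' := by
        rintro r x ⟨S, hS⟩
        exact ⟨S, fun S' h => by rw [smul_mul_assoc, hS _ h]⟩ }
  have key : ∀ a x, x * vertex G R a = x → x ∈ N := fun a x hx =>
    ⟨{a}, fun S' h => mul_vertexSum_of_mem (h (Finset.mem_singleton_self a)) hx⟩
  have hmul : ∀ y, ∀ x ∈ N, y * x ∈ N := by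
    rintro y x ⟨S, hS⟩
    exact ⟨S, fun S' h => by rw [mul_assoc, hS _ h]⟩
  exact mem_of_generators N (fun a => key a _ (vertex_mul_self a))
    (fun e => key _ _ (edge_mul_range e)) (fun e => key _ _ (ghost_mul_source e))
    (fun _ => hmul _) (fun _ => hmul _) (fun _ => hmul _) x

/-! ### Paths -/

variable (G R) in
/-- The element of the Leavitt path algebra given by a path that ends in `b`. -/
def path (b : V) : List E → G.LeavittPathAlgebra R
  | [] => vertex G R b
  | e :: p => edge G R e * path b p

variable (G R) in
/-- The element `p*` of the Leavitt path algebra given by a path `p` that ends in `b`. -/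
def ghostPath (b : V) : List E → G.LeavittPathAlgebra R
  | [] => vertex G R b
  | e :: p => ghostPath b p * ghost G R e

theorem path_mul_vertex (b : V) (p : List E) : path G R b p * vertex G R b = path G R b p := by
  induction p with
  | nil => exact vertex_mul_self b
  | cons e p ih => rw [path, mul_assoc, ih]

theorem vertex_mul_ghostPath (b : V) (p : List E) :
    vertex G R b * ghostPath G R b p = ghostPath G R b p := by
  induction p with
  | nil => exact vertex_mul_self b
  | cons e p ih => rw [ghostPath, ← mul_assoc, ih]

theorem vertex_mul_path {a b : V} {p : List E} (h : G.IsPath p a b) :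
    vertex G R a * path G R b p = path G R b p := by
  cases p with
  | nil => obtain rfl : a = b := h; exact vertex_mul_self a
  | cons e p => rw [path, ← mul_assoc, ← h.1, source_mul_edge]

theorem ghostPath_mul_vertex {a b : V} {p : List E} (h : G.IsPath p a b) :
    ghostPath G R b p * vertex G R a = ghostPath G R b p := by
  cases p with
  | nil => obtain rfl : a = b := h; exact vertex_mul_self a
  | cons e p => rw [ghostPath, mul_assoc, ← h.1, ghost_mul_source]

theorem path_append {b d : V} (p : List E) {q : List E} (h : G.IsPath q b d) :
    path G R d (p ++ q) = path G R b p * path G R d q := by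
  induction p with
  | nil => exact (vertex_mul_path h).symm
  | cons e p ih => rw [List.cons_append, path, ih, path, mul_assoc]

theorem ghostPath_mul_path {a b : V} {p : List E} (h : G.IsPath p a b) :
    ghostPath G R b p * path G R b p = vertex G R b := by
  induction p generalizing a with
  | nil => exact vertex_mul_self b
  | cons e p ih =>
    rw [ghostPath, path, mul_assoc, ← mul_assoc (ghost G R e), ghost_mul_edge_self,
      vertex_mul_path h.2, ih h.2]

theorem edge_mul_ghost_of_unique {e : E} (h : ∀ f, G.source e = G.source f → e = f) :
    edge G R e * ghost G R e = vertex G R (G.source e) := by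
  rw [vertex_eq_sum (S := {e}) (a := G.source e), Finset.sum_singleton]
  · intro f
    rw [Finset.mem_singleton]
    exact ⟨fun hf => by rw [hf], fun hf => (h f hf.symm).symm⟩
  · exact Finset.singleton_nonempty e

/-- Without exits, (CK2) reads `e e* = s(e)`, so the product collapses from the inside out. -/
theorem path_mul_ghostPath {a b : V} {p : List E} (h : G.IsPath p a b)
    (hp : ∀ e ∈ p, ∀ f, G.source e = G.source f → e = f) :
    path G R b p * ghostPath G R b p = vertex G R a := by
  induction p generalizing a with
  | nil => obtain rfl : a = b := h; exact vertex_mul_self a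
  | cons e p ih =>
    rw [path, ghostPath, mul_assoc, ← mul_assoc (path G R b p),
      ih h.2 fun f hf => hp f (List.mem_cons_of_mem e hf), range_mul_ghost,
      edge_mul_ghost_of_unique (hp e List.mem_cons_self), h.1]

end LeavittPathAlgebra

end

end DirectedGraph

/-! ### The representation on functions on infinite paths -/

namespace DirectedGraph

noncomputable section

variable {V : Type u} {E : Type v} (G : DirectedGraph V E) (R : Type w) [CommRing R]

/-- The sequence `e f₀ f₁ f₂ …`. -/
def consSeq (e : E) (f : ℕ → E) : ℕ → E
  | 0 => e
  | k + 1 => f k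

variable {G} in
theorem IsInfinitePath.tail {f : ℕ → E} (h : G.IsInfinitePath f) :
    G.IsInfinitePath fun k => f (k + 1) := fun k => h (k + 1)

variable {G} in
theorem IsInfinitePath.consSeq {f : ℕ → E} (h : G.IsInfinitePath f) {e : E}
    (he : G.range e = G.source (f 0)) : G.IsInfinitePath (consSeq e f)
  | 0 => he
  | k + 1 => h k

theorem consSeq_head_tail (f : ℕ → E) : DirectedGraph.consSeq (f 0) (fun k => f (k + 1)) = f := by
  funext k
  cases k <;> rfl

open Classical in
/-- The operators on functions on the sequences of edges that represent the generators of the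
Leavitt path algebra. They are supported on the infinite paths; an edge shifts the path and
multiplies by the variable. -/
def pathOperator :
    LeavittGen V E → Module.End R ((ℕ → E) → LaurentPolynomial R)
  | .vertex a =>
    { toFun := fun φ f => if G.IsInfinitePath f ∧ G.source (f 0) = a then φ f else 0
      map_add' := fun φ χ => by funext f; simp only [Pi.add_apply]; split_ifs <;> simp
      map_smul' := fun r φ => by
        funext f; simp only [Pi.smul_apply, RingHom.id_apply]; split_ifs <;> simp }
  | .edge e =>
    { toFun := fun φ f => if G.IsInfinitePath f ∧ f 0 = e then
        LaurentPolynomial.T 1 * φ (fun k => f (k + 1)) else 0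
      map_add' := fun φ χ => by
        funext f; simp only [Pi.add_apply]; split_ifs <;> simp [mul_add]
      map_smul' := fun r φ => by
        funext f; simp only [Pi.smul_apply, RingHom.id_apply]; split_ifs <;> simp }
  | .ghost e =>
    { toFun := fun φ f => if G.IsInfinitePath f ∧ G.range e = G.source (f 0) then
        LaurentPolynomial.T (-1) * φ (DirectedGraph.consSeq e f) else 0
      map_add' := fun φ χ => by
        funext f; simp only [Pi.add_apply]; split_ifs <;> simp [mul_add]
      map_smul' := fun r φ => by
        funext f; simp only [Pi.smul_apply, RingHom.id_apply]; split_ifs <;> simp }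

/-- The representation of the free algebra given by `pathOperator`. -/
def freePathRep : FreeLeavitt R V E →ₙₐ[R] Module.End R ((ℕ → E) → LaurentPolynomial R) :=
  MonoidAlgebra.liftMagma R (FreeSemigroup.lift (pathOperator G R))

theorem freePathRep_of (g : LeavittGen V E) :
    freePathRep G R (MonoidAlgebra.single (FreeSemigroup.of g) 1) = pathOperator G R g := by
  simp [freePathRep, MonoidAlgebra.liftMagma]

open Classical in
theorem freePathRep_vertex (a : V) (φ : (ℕ → E) → LaurentPolynomial R) (f : ℕ → E) :
    freePathRep G R (FreeLeavitt.vertex R a) φ f =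
      if G.IsInfinitePath f ∧ G.source (f 0) = a then φ f else 0 := by
  rw [FreeLeavitt.vertex, freePathRep_of]; rfl

open Classical in
theorem freePathRep_edge (e : E) (φ : (ℕ → E) → LaurentPolynomial R) (f : ℕ → E) :
    freePathRep G R (FreeLeavitt.edge R e) φ f =
      if G.IsInfinitePath f ∧ f 0 = e then
        LaurentPolynomial.T 1 * φ (fun k => f (k + 1)) else 0 := by
  rw [FreeLeavitt.edge, freePathRep_of]; rfl

open Classical in
theorem freePathRep_ghost (e : E) (φ : (ℕ → E) → LaurentPolynomial R) (f : ℕ → E) :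
    freePathRep G R (FreeLeavitt.ghost R e) φ f =
      if G.IsInfinitePath f ∧ G.range e = G.source (f 0) then
        LaurentPolynomial.T (-1) * φ (DirectedGraph.consSeq e f) else 0 := by
  rw [FreeLeavitt.ghost, freePathRep_of]; rfl

theorem T_one_mul_T_neg_one_mul (x : LaurentPolynomial R) :
    LaurentPolynomial.T 1 * (LaurentPolynomial.T (-1) * x) = x := by
  rw [← mul_assoc, ← LaurentPolynomial.T_add]; simp

theorem T_neg_one_mul_T_one_mul (x : LaurentPolynomial R) :
    LaurentPolynomial.T (-1) * (LaurentPolynomial.T 1 * x) = x := by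
  rw [← mul_assoc, ← LaurentPolynomial.T_add]; simp

variable {G R} in
-- Away from infinite paths all operators vanish. At an infinite path, removing and prepending an
-- edge are mutually inverse, and the first edge is unique, which gives (CK2).
theorem freePathRep_eq_of_leavittRel {x y : FreeLeavitt R V E} (h : G.LeavittRel R x y) :
    freePathRep G R x = freePathRep G R y := by
  classical
  refine LinearMap.ext fun φ => funext fun f => ?_
  by_cases hf : G.IsInfinitePath f
  swap
  · have hz : ∀ z, (∀ φ, freePathRep G R z φ f = 0) → ∀ z', ∀ φ,
        freePathRep G R (z * z') φ f = 0 := fun z hz z' φ => by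
      rw [map_mul]; exact hz _
    have h1 : ∀ a φ, freePathRep G R (FreeLeavitt.vertex R a) φ f = 0 := by
      simp [freePathRep_vertex, hf]
    have h2 : ∀ a φ, freePathRep G R (FreeLeavitt.edge R a) φ f = 0 := by
      simp [freePathRep_edge, hf]
    have h3 : ∀ a φ, freePathRep G R (FreeLeavitt.ghost R a) φ f = 0 := by
      simp [freePathRep_ghost, hf]
    cases h with
    | ck2 a S hS hne =>
      rw [h1, map_sum, LinearMap.sum_apply, Finset.sum_apply]
      exact (Finset.sum_eq_zero fun e _ => hz _ (h2 e) _ _).symm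
    | _ => simp [h1, h2, h3]
  · have ht := hf.tail
    have h01 := hf 0
    cases h with
    | ck2 a S hS hne =>
      rw [map_sum, LinearMap.sum_apply, Finset.sum_apply]
      simp only [map_mul, Module.End.mul_apply, freePathRep_vertex, freePathRep_edge,
        freePathRep_ghost, hf, ht, true_and]
      by_cases ha : G.source (f 0) = a
      · rw [Finset.sum_eq_single (f 0)]
        · rw [if_pos ha, if_pos rfl, if_pos h01, T_one_mul_T_neg_one_mul, consSeq_head_tail]
        · exact fun e _ he => if_neg he.symm
        · exact fun h => absurd ((hS _).2 ha) h
      · rw [if_neg ha, Finset.sum_eq_zero]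
        intro e he
        rw [if_neg]
        rintro rfl
        exact ha ((hS _).1 he)
    | vertex_mul_self a =>
      simp only [map_mul, Module.End.mul_apply, freePathRep_vertex]
      split_ifs <;> rfl
    | vertex_mul_of_ne a b hab =>
      simp only [map_mul, Module.End.mul_apply, freePathRep_vertex, hf, true_and, map_zero,
        LinearMap.zero_apply, Pi.zero_apply]
      split_ifs with h1 h2
      · exact absurd (h1.symm.trans h2) hab
      · rfl
      · rfl
    | source_mul_edge e =>
      simp only [map_mul, Module.End.mul_apply, freePathRep_vertex, freePathRep_edge, hf, true_and]
      split_ifs with h1 h2 h2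
      · rfl
      · rfl
      · exact absurd (by rw [h2]) h1
      · rfl
    | edge_mul_range e =>
      simp only [map_mul, Module.End.mul_apply, freePathRep_vertex, freePathRep_edge, hf, ht,
        true_and]
      split_ifs with h1 h2
      · rfl
      · exact absurd (by rw [← h01, h1]) h2
      · rfl
    | range_mul_ghost e =>
      simp only [map_mul, Module.End.mul_apply, freePathRep_vertex, freePathRep_ghost, hf, true_and]
      split_ifs with h1 h2 h2
      · rfl
      · rfl
      · exact absurd h2.symm h1
      · rfl
    | ghost_mul_source e =>
      simp only [map_mul, Module.End.mul_apply, freePathRep_vertex, freePathRep_ghost, hf, true_and]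
      split_ifs with h1 h2
      · rfl
      · exact absurd ⟨hf.consSeq h1, rfl⟩ h2
      · rfl
    | ghost_mul_edge_self e =>
      simp only [map_mul, Module.End.mul_apply, freePathRep_vertex, freePathRep_edge,
        freePathRep_ghost, hf, true_and, eq_comm (a := G.source (f 0))]
      split_ifs with h1 h2
      · exact T_neg_one_mul_T_one_mul R _
      · exact absurd ⟨hf.consSeq h1, rfl⟩ h2
      · rfl
    | ghost_mul_edge_of_ne e e' hne =>
      simp only [map_mul, Module.End.mul_apply, freePathRep_edge, freePathRep_ghost, hf, true_and,
        map_zero, LinearMap.zero_apply, Pi.zero_apply]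
      split_ifs with h1 h2
      · exact absurd h2.2 hne
      · exact mul_zero _
      · rfl

/-- The representation of the Leavitt path algebra on functions on the infinite paths. -/
def pathRep : G.LeavittPathAlgebra R →ₗ[R] Module.End R ((ℕ → E) → LaurentPolynomial R) :=
  Submodule.liftQ _ (freePathRep G R : FreeLeavitt R V E →ₗ[R]
    Module.End R ((ℕ → E) → LaurentPolynomial R)) (by
    refine sInf_le (a := LinearMap.ker (freePathRep G R : FreeLeavitt R V E →ₗ[R]
    Module.End R ((ℕ → E) → LaurentPolynomial R))) ⟨?_, ?_⟩
    · intro x y h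
      rw [LinearMap.mem_ker, map_sub, sub_eq_zero]
      exact freePathRep_eq_of_leavittRel h
    · intro a x hx
      have hx' : freePathRep G R x = 0 := hx
      constructor
      · exact (map_mul (freePathRep G R) a x).trans (by rw [hx', mul_zero])
      · exact (map_mul (freePathRep G R) x a).trans (by rw [hx', zero_mul]))

theorem pathRep_mk (x : FreeLeavitt R V E) :
    pathRep G R (LeavittPathAlgebra.mk G R x) = freePathRep G R x := rfl

theorem pathRep_mul (x y : G.LeavittPathAlgebra R) :
    pathRep G R (x * y) = pathRep G R x * pathRep G R y := by
  obtain ⟨x, rfl⟩ := LeavittPathAlgebra.mk_surjective G R x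
  obtain ⟨y, rfl⟩ := LeavittPathAlgebra.mk_surjective G R y
  rw [← LeavittPathAlgebra.mk_mul, pathRep_mk, pathRep_mk, pathRep_mk, map_mul]

variable {G R}

theorem pathRep_vertex_apply {a : V} {f : ℕ → E} (hf : G.IsInfinitePath f)
    (ha : G.source (f 0) = a) (φ : (ℕ → E) → LaurentPolynomial R) :
    pathRep G R (LeavittPathAlgebra.vertex G R a) φ f = φ f := by
  rw [LeavittPathAlgebra.vertex, pathRep_mk, freePathRep_vertex, if_pos ⟨hf, ha⟩]

/-- The exponent of the variable records the length of the removed prefix; this is what later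
separates the powers of the cycle. -/
theorem pathRep_path_apply {b : V} {p : List E} {f : ℕ → E} (hf : G.IsInfinitePath f)
    (hp : ∀ i (hi : i < p.length), f i = p[i]) (hb : G.source (f p.length) = b)
    (φ : (ℕ → E) → LaurentPolynomial R) :
    pathRep G R (LeavittPathAlgebra.path G R b p) φ f =
      LaurentPolynomial.T p.length * φ (fun k => f (k + p.length)) := by
  induction p generalizing f with
  | nil => simpa [LeavittPathAlgebra.path] using pathRep_vertex_apply hf hb φ
  | cons e p ih =>
    rw [LeavittPathAlgebra.path, pathRep_mul, LeavittPathAlgebra.edge, pathRep_mk,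
      Module.End.mul_apply, freePathRep_edge, if_pos ⟨hf, hp 0 (by simp)⟩,
      ih hf.tail (fun i hi => hp (i + 1) (by simpa using hi)) hb,
      ← mul_assoc, ← LaurentPolynomial.T_add, List.length_cons, Nat.cast_add, Nat.cast_one,
      add_comm (1 : ℤ)]
    rfl

end

end DirectedGraph

/-! ### The corner at the base vertex -/

namespace DirectedGraph

noncomputable section

variable {V : Type u} {E : Type v} {G : DirectedGraph V E} {R : Type w} [CommRing R]

namespace LeavittPathAlgebra

theorem isIdempotentElem_vertex (a : V) : IsIdempotentElem (vertex G R a) := vertex_mul_self a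

end LeavittPathAlgebra

namespace IsBasedComet

open LeavittPathAlgebra

variable {c : List E} {a : V}

theorem path_mul_ghostPath_cycle (h : G.IsBasedComet c a) :
    path G R a c * ghostPath G R a c = vertex G R a :=
  path_mul_ghostPath h.isPath fun e he f hef =>
    h.eq_of_source_eq e f (h.isPath.reaches_source_of_mem he).1 hef

variable (R) in
/-- The cycle of a comet as a unit of the corner at its base vertex. -/
def cycleUnit (h : G.IsBasedComet c a) : (isIdempotentElem_vertex (G := G) (R := R) a).Cornerˣ where
  val := ⟨path G R a c, (Subsemigroup.mem_corner_iff (isIdempotentElem_vertex a)).2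
    ⟨vertex_mul_path h.isPath, path_mul_vertex a c⟩⟩
  inv := ⟨ghostPath G R a c, (Subsemigroup.mem_corner_iff (isIdempotentElem_vertex a)).2
    ⟨vertex_mul_ghostPath a c, ghostPath_mul_vertex h.isPath⟩⟩
  val_inv := Subtype.ext h.path_mul_ghostPath_cycle
  inv_val := Subtype.ext (ghostPath_mul_path h.isPath)

variable (R) in
/-- The power `c ^ k` of the cycle of a comet, where `c ^ (-1) = c*`. -/
def cyclePow (h : G.IsBasedComet c a) (k : ℤ) : G.LeavittPathAlgebra R :=
  ((h.cycleUnit R ^ k : (isIdempotentElem_vertex (G := G) (R := R) a).Cornerˣ) :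
    (isIdempotentElem_vertex (G := G) (R := R) a).Corner).1

theorem cyclePow_zero (h : G.IsBasedComet c a) : h.cyclePow R 0 = vertex G R a := rfl

theorem cyclePow_one (h : G.IsBasedComet c a) : h.cyclePow R 1 = path G R a c := by
  rw [cyclePow, zpow_one]; rfl

theorem cyclePow_neg_one (h : G.IsBasedComet c a) : h.cyclePow R (-1) = ghostPath G R a c := by
  rw [cyclePow, zpow_neg_one]; rfl

theorem cyclePow_add (h : G.IsBasedComet c a) (k l : ℤ) :
    h.cyclePow R (k + l) = h.cyclePow R k * h.cyclePow R l := by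
  rw [cyclePow, zpow_add]; rfl

theorem vertex_mul_cyclePow (h : G.IsBasedComet c a) (k : ℤ) :
    vertex G R a * h.cyclePow R k = h.cyclePow R k := by
  rw [← h.cyclePow_zero, ← cyclePow_add, zero_add]

variable (R) in
/-- The homomorphism from Laurent polynomials that evaluates the variable at the cycle. -/
def laurentHom (h : G.IsBasedComet c a) : LaurentPolynomial R →ₙₐ[R] G.LeavittPathAlgebra R :=
  AddMonoidAlgebra.liftMagma R
    { toFun := fun k => h.cyclePow R k.toAdd
      map_mul' := fun _ _ => h.cyclePow_add _ _ }

theorem laurentHom_single (h : G.IsBasedComet c a) (k : ℤ) (r : R) :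
    h.laurentHom R (AddMonoidAlgebra.single k r) = r • h.cyclePow R k := by
  simp [laurentHom, AddMonoidAlgebra.liftMagma, -LaurentPolynomial.single_eq_C_mul_T]

theorem laurentHom_one (h : G.IsBasedComet c a) : h.laurentHom R 1 = vertex G R a := by
  rw [AddMonoidAlgebra.one_def, laurentHom_single, one_smul, cyclePow_zero]

/-! ### Independence of the powers of the cycle -/

theorem source_cycleForever_zero (h : G.IsBasedComet c a) :
    G.source (cycleForever c h.ne_nil 0) = a := by
  have h1 := h.isPath
  have h2 := h.ne_nil
  cases c with
  | nil => exact absurd rfl h2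
  | cons e c => exact h1.1

/-- Removing one turn from `c c c …` leaves it unchanged, so at this point `c` acts purely as
multiplication by a power of the variable. -/
theorem pathRep_cyclePow_apply (h : G.IsBasedComet c a) (k : ℤ)
    (φ : (ℕ → E) → LaurentPolynomial R) :
    pathRep G R (h.cyclePow R k) φ (cycleForever c h.ne_nil) =
      LaurentPolynomial.T (k * c.length) * φ (cycleForever c h.ne_nil) := by
  have hf := h.isPath.isInfinitePath_cycleForever h.ne_nil
  have h0 := h.source_cycleForever_zero
  have hv : ∀ φ, pathRep G R (vertex G R a) φ (cycleForever c h.ne_nil) =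
      φ (cycleForever c h.ne_nil) := pathRep_vertex_apply hf h0
  have h1 : ∀ φ, pathRep G R (path G R a c) φ (cycleForever c h.ne_nil) =
      LaurentPolynomial.T c.length * φ (cycleForever c h.ne_nil) := by
    intro φ
    rw [pathRep_path_apply hf]
    · congr 2
      funext k
      simp [cycleForever]
    · intro i hi
      simp [cycleForever, Nat.mod_eq_of_lt hi]
    · refine Eq.trans ?_ h0
      simp [cycleForever]
  have h2 : ∀ φ, pathRep G R (ghostPath G R a c) φ (cycleForever c h.ne_nil) =
      LaurentPolynomial.T (-c.length) * φ (cycleForever c h.ne_nil) := by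
    intro φ
    -- `c c*` acts as the identity here, so the factor of `c*` is the inverse of that of `c`.
    have := h1 (pathRep G R (ghostPath G R a c) φ)
    rw [← Module.End.mul_apply, ← pathRep_mul, h.path_mul_ghostPath_cycle, hv] at this
    rw [this, ← mul_assoc, ← LaurentPolynomial.T_add]
    simp
  induction k using Int.induction_on with
  | zero => simp [cyclePow_zero, hv]
  | succ k ih =>
    rw [add_comm, cyclePow_add, cyclePow_one, pathRep_mul, Module.End.mul_apply, h1, ih,
      ← mul_assoc, ← LaurentPolynomial.T_add]
    ring_nf
  | pred k ih =>
    rw [sub_eq_neg_add, cyclePow_add, cyclePow_neg_one, pathRep_mul, Module.End.mul_apply, h2, ih,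
      ← mul_assoc, ← LaurentPolynomial.T_add]
    ring_nf

/-- Acting on the constant function `1` and evaluating at `c c c …` turns `p(x)` into `p(x ^ n)`
with `n = c.length ≠ 0`, from which `p` can be recovered. -/
theorem laurentHom_injective (h : G.IsBasedComet c a) :
    Function.Injective (h.laurentHom R) := by
  have hn : (c.length : ℤ) ≠ 0 := by
    simpa using h.ne_nil
  have hmap : ∀ p : LaurentPolynomial R,
      pathRep G R (h.laurentHom R p) (fun _ => 1) (cycleForever c h.ne_nil) =
        AddMonoidAlgebra.mapDomain (· * (c.length : ℤ)) p := by
    intro p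
    induction p using AddMonoidAlgebra.induction_linear with
    | zero => simp
    | add p q hp hq =>
      rw [map_add, map_add, LinearMap.add_apply, Pi.add_apply, hp, hq,
        AddMonoidAlgebra.mapDomain_add]
    | single k r =>
      rw [laurentHom_single, map_smul, LinearMap.smul_apply, Pi.smul_apply,
        pathRep_cyclePow_apply, AddMonoidAlgebra.mapDomain_single, mul_one, LaurentPolynomial.T,
        AddMonoidAlgebra.smul_single, smul_eq_mul, mul_one]
  intro p q hpq
  refine AddMonoidAlgebra.mapDomain_injective (mul_left_injective₀ hn) ?_
  rw [← hmap, ← hmap, hpq]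

/-! ### The corner at the base vertex -/

/-- Turns of `c` are split off one at a time; the length bound `n` drives the induction, since each
turn has positive length. -/
theorem path_mem_range (h : G.IsBasedComet c a) (n : ℕ) {p : List E} (hn : p.length ≤ n)
    (hp : G.IsPath p a a) : ∃ k, path G R a p = h.cyclePow R k := by
  induction n generalizing p with
  | zero =>
    obtain rfl : p = [] := by simpa using hn
    exact ⟨0, rfl⟩
  | succ n ih =>
    rcases eq_or_ne p [] with rfl | hne
    · exact ⟨0, rfl⟩
    · obtain ⟨q, rfl, hq⟩ := h.exists_eq_append hp hne
      have := List.length_pos_of_ne_nil h.ne_nil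
      rw [List.length_append] at hn
      obtain ⟨k, hk⟩ := ih (by omega) hq
      exact ⟨1 + k, by rw [path_append c hq, hk, cyclePow_add, cyclePow_one]⟩

variable (R) in
/-- The span of the elements `p c ^ k`, where `p` is a path that ends in the base vertex. -/
def pathSpan (h : G.IsBasedComet c a) : Submodule R (G.LeavittPathAlgebra R) :=
  Submodule.span R {x | ∃ b p k, G.IsPath p b a ∧ x = path G R a p * h.cyclePow R k}

theorem path_mul_cyclePow_mem (h : G.IsBasedComet c a) {b : V} {p : List E} (hp : G.IsPath p b a)
    (k : ℤ) : path G R a p * h.cyclePow R k ∈ h.pathSpan R :=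
  Submodule.subset_span ⟨b, p, k, hp, rfl⟩

theorem mul_mem_pathSpan (h : G.IsBasedComet c a) {g : G.LeavittPathAlgebra R}
    (hg : ∀ b p k, G.IsPath p b a → g * (path G R a p * h.cyclePow R k) ∈ h.pathSpan R)
    {x : G.LeavittPathAlgebra R} (hx : x ∈ h.pathSpan R) : g * x ∈ h.pathSpan R := by
  induction hx using Submodule.span_induction with
  | mem x hx =>
    obtain ⟨b, p, k, hp, rfl⟩ := hx
    exact hg b p k hp
  | zero => simp
  | add x y _ _ hx hy => rw [mul_add]; exact Submodule.add_mem _ hx hy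
  | smul r x _ hx => rw [mul_smul_comm]; exact Submodule.smul_mem _ r hx

theorem vertex_mul_mem_pathSpan (h : G.IsBasedComet c a) (d : V) {x : G.LeavittPathAlgebra R}
    (hx : x ∈ h.pathSpan R) : vertex G R d * x ∈ h.pathSpan R := by
  refine h.mul_mem_pathSpan (fun b p k hp => ?_) hx
  rw [← mul_assoc]
  rcases eq_or_ne d b with rfl | hne
  · rw [vertex_mul_path hp]; exact h.path_mul_cyclePow_mem hp k
  · rw [← vertex_mul_path hp, ← mul_assoc, vertex_mul_of_ne hne]; simp

theorem edge_mul_mem_pathSpan (h : G.IsBasedComet c a) (e : E) {x : G.LeavittPathAlgebra R}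
    (hx : x ∈ h.pathSpan R) : edge G R e * x ∈ h.pathSpan R := by
  refine h.mul_mem_pathSpan (fun b p k hp => ?_) hx
  rw [← mul_assoc]
  rcases eq_or_ne (G.range e) b with rfl | hne
  · exact h.path_mul_cyclePow_mem (p := e :: p) ⟨rfl, hp⟩ k
  · rw [← vertex_mul_path hp, ← edge_mul_range, ← mul_assoc, mul_assoc (edge G R e),
      vertex_mul_of_ne hne]
    simp

/-- A ghost edge cancels or annihilates the first edge of a nonempty path; the empty path is first
traded for a turn of `c`. -/
theorem ghost_mul_mem_pathSpan (h : G.IsBasedComet c a) (e : E) {x : G.LeavittPathAlgebra R}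
    (hx : x ∈ h.pathSpan R) : ghost G R e * x ∈ h.pathSpan R := by
  have key : ∀ b f p k, G.IsPath (f :: p) b a →
      ghost G R e * (path G R a (f :: p) * h.cyclePow R k) ∈ h.pathSpan R := by
    intro b f p k hp
    rw [path, ← mul_assoc, ← mul_assoc]
    rcases eq_or_ne e f with rfl | hne
    · rw [ghost_mul_edge_self, vertex_mul_path hp.2]
      exact h.path_mul_cyclePow_mem hp.2 k
    · rw [ghost_mul_edge_of_ne hne]; simp
  refine h.mul_mem_pathSpan (fun b p k hp => ?_) hx
  cases p with
  | nil =>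
    -- Borrows one factor `c` from `c ^ k`, so that there is a first edge to meet the ghost edge.
    have hk : path G R a [] * h.cyclePow R k = path G R a c * h.cyclePow R (k - 1) := by
      rw [← h.cyclePow_one, ← cyclePow_add, add_sub_cancel]
      exact h.vertex_mul_cyclePow k
    obtain ⟨f, q, hfq⟩ := List.exists_cons_of_ne_nil h.ne_nil
    have hc := h.isPath
    rw [hfq] at hc
    have := key a f q (k - 1) hc
    rwa [← hfq, ← hk] at this
  | cons f p => exact key b f p k hp

/-- `pathSpan` contains `a` and is stable under left multiplication by generators, so it contains
the left ideal generated by `a`. -/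
theorem mul_vertex_mem_pathSpan (h : G.IsBasedComet c a) (x : G.LeavittPathAlgebra R) :
    x * vertex G R a ∈ h.pathSpan R := by
  have ha : vertex G R a ∈ h.pathSpan R := by
    have := h.path_mul_cyclePow_mem (R := R) (p := []) (b := a) rfl 0
    rwa [path, vertex_mul_cyclePow] at this
  let N : Submodule R (G.LeavittPathAlgebra R) :=
    { carrier := {x | x * vertex G R a ∈ h.pathSpan R}
      zero_mem' := by simp
      add_mem' := fun {x y} hx hy => by
        change (x + y) * vertex G R a ∈ h.pathSpan R
        rw [add_mul]; exact Submodule.add_mem _ hx hy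
      smul_mem' := fun r x hx => by
        change (r • x) * vertex G R a ∈ h.pathSpan R
        rw [smul_mul_assoc]; exact Submodule.smul_mem _ r hx }
  refine mem_of_generators N (fun d => h.vertex_mul_mem_pathSpan d ha)
    (fun e => h.edge_mul_mem_pathSpan e ha) (fun e => h.ghost_mul_mem_pathSpan e ha)
    (fun d x hx => ?_) (fun e x hx => ?_) (fun e x hx => ?_) x
  · change vertex G R d * x * vertex G R a ∈ h.pathSpan R
    rw [mul_assoc]; exact h.vertex_mul_mem_pathSpan d hx
  · change edge G R e * x * vertex G R a ∈ h.pathSpan R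
    rw [mul_assoc]; exact h.edge_mul_mem_pathSpan e hx
  · change ghost G R e * x * vertex G R a ∈ h.pathSpan R
    rw [mul_assoc]; exact h.ghost_mul_mem_pathSpan e hx

/-- Multiplying `p c ^ k` by `a` on the left kills it unless `p` starts at `a`; then `p` is closed,
hence a power of `c`. -/
theorem corner_mem_range (h : G.IsBasedComet c a) (x : G.LeavittPathAlgebra R) :
    vertex G R a * x * vertex G R a ∈ Set.range (h.laurentHom R) := by
  have hx := h.mul_vertex_mem_pathSpan x
  rw [mul_assoc]
  generalize x * vertex G R a = y at hx
  induction hx using Submodule.span_induction with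
  | mem y hy =>
    obtain ⟨b, p, k, hp, rfl⟩ := hy
    rcases eq_or_ne a b with rfl | hne
    · obtain ⟨l, hl⟩ := h.path_mem_range (R := R) p.length le_rfl hp
      refine ⟨AddMonoidAlgebra.single (l + k) 1, ?_⟩
      rw [laurentHom_single, one_smul, hl, ← cyclePow_add, vertex_mul_cyclePow]
    · refine ⟨0, ?_⟩
      rw [map_zero, ← vertex_mul_path hp, ← mul_assoc, ← mul_assoc, vertex_mul_of_ne hne, zero_mul,
        zero_mul]
  | zero => exact ⟨0, by simp⟩
  | add y z _ _ hy hz =>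
    obtain ⟨p, hp⟩ := hy
    obtain ⟨q, hq⟩ := hz
    exact ⟨p + q, by rw [map_add, hp, hq, mul_add]⟩
  | smul r y _ hy =>
    obtain ⟨p, hp⟩ := hy
    exact ⟨r • p, by rw [map_smul, hp, mul_smul_comm]⟩

/-! ### Fullness and nondegeneracy -/

/-- If all edges out of a regular vertex end in the ideal `I`, then (CK2) puts the vertex in `I`. A
vertex outside `I` thus always has a successor outside `I`, and iterating gives an infinite path
that never meets `a`. -/
theorem vertex_mem_span (h : G.IsBasedComet c a) (hrow : G.RowFinite) (b : V) :
    vertex G R b ∈ Submodule.span R {z | ∃ x y, z = x * vertex G R a * y} := by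
  set I := Submodule.span R {z | ∃ x y, z = x * vertex G R a * y} with hI
  have hmul : ∀ s t x, x ∈ I → s * x * t ∈ I := by
    intro s t x hx
    induction hx using Submodule.span_induction with
    | mem x hx =>
      obtain ⟨y, z, rfl⟩ := hx
      exact Submodule.subset_span ⟨s * y, z * t, by simp only [mul_assoc]⟩
    | zero => simp
    | add x y _ _ hx hy => rw [mul_add, add_mul]; exact I.add_mem hx hy
    | smul r x _ hx => rw [mul_smul_comm, smul_mul_assoc]; exact I.smul_mem r hx
  have ha : vertex G R a ∈ I :=
    Submodule.subset_span ⟨vertex G R a, vertex G R a, by simp only [vertex_mul_self]⟩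
  have step : ∀ d : {d : V // vertex G R d ∉ I},
      ∃ e, G.source e = d.1 ∧ vertex G R (G.range e) ∉ I := by
    rintro ⟨d, hd⟩
    by_contra! hcon
    apply hd
    -- (CK2) needs an edge out of `d`: take the first edge of a path to `a`, which is nonempty since
    -- `d ≠ a`.
    have hne : (hrow d).toFinset.Nonempty := by
      obtain ⟨p, hp⟩ := h.reaches d
      cases p with
      | nil =>
        obtain rfl : d = a := hp
        exact absurd ha hd
      | cons e p => exact ⟨e, by simpa using hp.1⟩
    rw [vertex_eq_sum (S := (hrow d).toFinset) (by simp) hne]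
    refine I.sum_mem fun e he => ?_
    -- Writing `e e* = e r(e) e*` exhibits a factor in `I`.
    rw [← edge_mul_range]
    exact hmul _ _ _ (hcon e (by simpa using he))
  choose next hnext hnext' using step
  by_contra hb
  let vs : ℕ → {d : V // vertex G R d ∉ I} := fun n =>
    Nat.rec ⟨b, hb⟩ (fun _ d => ⟨G.range (next d), hnext' d⟩) n
  obtain ⟨k, hk⟩ := h.exists_source_eq (fun n => next (vs n)) fun n => (hnext (vs (n + 1))).symm
  rw [hnext] at hk
  exact (vs k).2 (hk ▸ ha)

theorem span_eq_top (h : G.IsBasedComet c a) (hrow : G.RowFinite) :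
    Submodule.span R {z | ∃ x y, z = x * vertex G R a * y} = ⊤ := by
  rw [eq_top_iff]
  rintro x -
  obtain ⟨S, hS⟩ := exists_vertexSum_mul x
  rw [← hS S subset_rfl, vertexSum, Finset.sum_mul]
  refine Submodule.sum_mem _ fun b _ => ?_
  have := h.vertex_mem_span (R := R) hrow b
  generalize vertex G R b = v at this
  induction this using Submodule.span_induction with
  | mem z hz =>
    obtain ⟨s, t, rfl⟩ := hz
    exact Submodule.subset_span ⟨s, t * x, by simp only [mul_assoc]⟩
  | zero => simp
  | add y z _ _ hy hz => rw [add_mul]; exact Submodule.add_mem _ hy hz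
  | smul r y _ hy => rw [smul_mul_assoc]; exact Submodule.smul_mem _ r hy

/-- Fullness turns the hypothesis into `s w t = 0` for all `s` and `t`, and local units for `w`
finish. -/
theorem eq_zero_of_corner_eq_zero (h : G.IsBasedComet c a) (hrow : G.RowFinite)
    (w : G.LeavittPathAlgebra R)
    (hw : ∀ x y, vertex G R a * x * w * y * vertex G R a = 0) : w = 0 := by
  have htop : ∀ z, z ∈ Submodule.span R {z | ∃ x y, z = x * vertex G R a * y} := fun z => by
    rw [h.span_eq_top hrow]; trivial
  have h1 : ∀ s x, s * w * x * vertex G R a = 0 := by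
    intro s x
    induction htop s using Submodule.span_induction with
    | mem z hz =>
      obtain ⟨y, t, rfl⟩ := hz
      calc _ = y * (vertex G R a * t * w * x * vertex G R a) := by simp only [mul_assoc]
        _ = 0 := by rw [hw, mul_zero]
    | zero => simp
    | add y z _ _ hy hz => simp only [add_mul, hy, hz, add_zero]
    | smul r y _ hy => simp only [smul_mul_assoc, hy, smul_zero]
  have h2 : ∀ s t, s * w * t = 0 := by
    intro s t
    induction htop t using Submodule.span_induction with
    | mem z hz =>
      obtain ⟨x, y, rfl⟩ := hz
      rw [← mul_assoc, ← mul_assoc, h1, zero_mul]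
    | zero => simp
    | add y z _ _ hy hz => simp only [mul_add, hy, hz, add_zero]
    | smul r y _ hy => simp only [mul_smul_comm, hy, smul_zero]
  obtain ⟨S, hS⟩ := exists_vertexSum_mul w
  obtain ⟨T, hT⟩ := exists_mul_vertexSum w
  rw [← hT T subset_rfl, ← hS S subset_rfl, h2]

end IsBasedComet

end

end DirectedGraph

theorem mainTheorem4 {V : Type u} {E : Type v} (K : Type w) [Field K] (G : DirectedGraph V E)
    (hrow : G.RowFinite) (hcomet : G.IsComet) :
    Nonempty (centroidAlgebra K (G.LeavittPathAlgebra K) ≃ₐ[K] LaurentPolynomial K) := by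
  obtain ⟨c, a, h⟩ := hcomet.exists_isBasedComet
  refine nonempty_centroidAlgebra_equiv_of_full_corner (h.laurentHom K) h.laurentHom_injective ?_ ?_
    ?_ <;> simp only [h.laurentHom_one]
  exacts [h.corner_mem_range, h.span_eq_top hrow, h.eq_zero_of_corner_eq_zero hrow]
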